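/- Let $(Y,d)$ be a metric space and let $R=(Y,\tau_j,q_j)_{0\le j\le n-1}$ be an iterated function system with weights: each $\tau_j:Y\to Y$ is a contraction (it has a Lipschitz constant $<1$) and each $q_j:Y\to(0,\infty)$ is a continuous function satisfying the Dini condition $$\int_0^1 \sup_{d(x,y)\le t}\frac{|\ln q_j(x)-\ln q_j(y)|}{t}\,dt<+\infty .$$ Let $K\subseteq Y$ be the attractor, that is, a nonempty compact set with $\bigcup_{j=0}^{n-1}\tau_j(K)=K$. For a continuous function $f$ put $B_R(f)(x)=\sum_{j=0}^{n-1}q_j(x)f(\tau_j x)$, and let $\rho$ be the spectral radius of $B_R$ acting on the Banach space $C(K)$. Let $\mu$ be a Borel probability measure on $K$ with $B_R^*\mu=\rho\,\mu$, that is, $\int_K B_R(f)\,d\mu=\rho\int_K f\,d\mu$ for every $f\in C(K)$. Then for every point $x_0\in Y$ and every continuous $f:Y\to\mathbb R$, $$\lim_{k\to\infty}\frac{B_R^{k}(f)(x_0)}{B_R^{k}(1)(x_0)}=\int_K f\,d\mu .$$ -/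

import Mathlib

open MeasureTheory Filter Topology

/-- An iterated function system with weights `(Y, τ_j, q_j)`, `0 ≤ j ≤ n - 1`: finitely many
continuous self-maps `τ_j` of `Y` together with positive continuous weights `q_j`, which need not
sum to one. -/
structure IFSw (n : ℕ) (Y : Type*) [TopologicalSpace Y] where
  /-- the maps `τ_j` -/
  map : Fin n → C(Y, Y)
  /-- the weights `q_j` -/
  weight : Fin n → C(Y, ℝ)
  weight_pos : ∀ j x, 0 < weight j x

namespace IFSw

variable {n : ℕ}

/-- The transfer (Hutchinson–Barnsley) operator `B_R(f)(x) = ∑ j, q_j(x) f(τ_j x)` on continuous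
functions. -/
noncomputable def transfer (𝕜 : Type*) [RCLike 𝕜] {Y : Type*} [TopologicalSpace Y]
    (R : IFSw n Y) : C(Y, 𝕜) →ₗ[𝕜] C(Y, 𝕜) where
  toFun f := ⟨fun x => ∑ j, ((R.weight j x : ℝ) : 𝕜) * f (R.map j x), by fun_prop⟩
  map_add' f g := by
    ext x
    simp [mul_add, Finset.sum_add_distrib]
  map_smul' c f := by
    ext x
    simp [Finset.mul_sum, mul_left_comm]

/-- The transfer operator as a bounded operator on the Banach space `C(Y, 𝕜)` with the sup norm,
`Y` compact. -/
noncomputable def transferCLM (𝕜 : Type*) [RCLike 𝕜] {Y : Type*} [TopologicalSpace Y]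
    [CompactSpace Y] (R : IFSw n Y) : C(Y, 𝕜) →L[𝕜] C(Y, 𝕜) where
  toLinearMap := R.transfer 𝕜
  cont := by
    have h : (fun f : C(Y, 𝕜) => R.transfer 𝕜 f) = fun f => ∑ j,
        (⟨fun x => ((R.weight j x : ℝ) : 𝕜), by fun_prop⟩ : C(Y, 𝕜)) * f.comp (R.map j) := by
      funext f
      ext x
      simp [transfer]
    change Continuous fun f : C(Y, 𝕜) => R.transfer 𝕜 f
    rw [h]
    exact continuous_finsetSum _ fun j _ =>
      continuous_const.mul (ContinuousMap.continuous_precomp (R.map j))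

/-- The nonempty compact set `K` is the attractor of the maps: `⋃ j, τ_j(K) = K`.
(For contractions there is at most one such set.) -/
def IsAttractor {Y : Type*} [TopologicalSpace Y] (R : IFSw n Y)
    (K : TopologicalSpace.NonemptyCompacts Y) : Prop :=
  ⋃ j, R.map j '' (K : Set Y) = K

theorem IsAttractor.mapsTo {Y : Type*} [TopologicalSpace Y] {R : IFSw n Y}
    {K : TopologicalSpace.NonemptyCompacts Y} (h : R.IsAttractor K) (j : Fin n) :
    Set.MapsTo (R.map j) (K : Set Y) (K : Set Y) := fun x hx => by
  rw [← h]
  exact Set.mem_iUnion.2 ⟨j, x, hx, rfl⟩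

/-- The restriction of an IFSw to its attractor. -/
def onAttractor {Y : Type*} [TopologicalSpace Y] (R : IFSw n Y)
    {K : TopologicalSpace.NonemptyCompacts Y} (hK : R.IsAttractor K) : IFSw n K where
  map j := ⟨fun x => ⟨R.map j x, hK.mapsTo j x.2⟩, by fun_prop⟩
  weight j := ⟨fun x => R.weight j x, by fun_prop⟩
  weight_pos j x := R.weight_pos j x

/-- The spectral radius `ρ` of the transfer operator acting on the complex Banach space
`C(Y, ℂ)`, `Y` compact. -/
noncomputable def specRadius {Y : Type*} [TopologicalSpace Y] [CompactSpace Y]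
    (R : IFSw n Y) : ℝ :=
  (spectralRadius ℂ (R.transferCLM ℂ)).toReal

/-- `B_R^* μ = c μ`, where `B_R^*` is the dual of the transfer operator acting on the finite Borel
measures of the compact space `Y`: `∫ B_R(f) dμ = c ∫ f dμ` for all continuous `f`. -/
def IsEigenmeasure {Y : Type*} [TopologicalSpace Y] [CompactSpace Y] [MeasurableSpace Y]
    (R : IFSw n Y) (c : ℝ) (μ : Measure Y) : Prop :=
  ∀ f : C(Y, ℝ), ∫ x, R.transfer ℝ f x ∂μ = c * ∫ x, f x ∂μ

/-- Every map is a contraction: it has a Lipschitz constant less than one. -/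
def Contractive {Y : Type*} [MetricSpace Y] (R : IFSw n Y) : Prop :=
  ∀ j, ∃ c, ContractingWith c (R.map j)

end IFSw

/-- The modulus of continuity `t ↦ sup {|u x - u y| : d(x, y) ≤ t}`, with values in `[0, ∞]`. -/
noncomputable def oscModulus {Y : Type*} [MetricSpace Y] (u : Y → ℝ) (t : ℝ) : ENNReal :=
  ⨆ (x : Y) (y : Y) (_ : dist x y ≤ t), ENNReal.ofReal |u x - u y|

/-- The Dini condition on a positive weight `q`:
`∫_0^1 sup_{d(x, y) ≤ t} |ln q(x) - ln q(y)| / t dt < ∞`. -/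
def DiniWeight {Y : Type*} [MetricSpace Y] (q : Y → ℝ) : Prop :=
  ∫⁻ t in Set.Ioc (0 : ℝ) 1, oscModulus (fun x => Real.log (q x)) t / ENNReal.ofReal t < ⊤

/-! Adjoin to `K` the forward orbit of `x₀`. The orbit accumulates only on `K`, so the union `X` is
compact, and every map sends it into itself. The Dini condition makes the oscillations of the `log
q_j` summable along geometric scales, which bounds the distortion of products of weights along words
of any length by one constant `C` (`transfer_pow_le_exp_sum_mul`, `exists_summable_log_weight_osc`).

On `X`, each value of `B^(k+1) f / B^(k+1) 1` is a weighted average of values of `B^k f / B^k 1`, so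
the minima `m k` increase and the maxima `M k` decrease. Bounded distortion forces their limits to
coincide (`exists_tendsto_bounds`). Integrating `m k * B^k 1 ≤ B^k f ≤ M k * B^k 1` over `K` and
cancelling `ρ ^ k` gives `m k ≤ ∫ f ≤ M k`, so the common limit is the integral. -/

namespace IFSw

variable {n : ℕ}

/-! ### Positivity and integrals of iterates of the transfer operator. -/

section TransferIterates

variable {Y : Type*} [TopologicalSpace Y] (R : IFSw n Y)

theorem transfer_apply (f : C(Y, ℝ)) (x : Y) :
    R.transfer ℝ f x = ∑ j, R.weight j x * f (R.map j x) := by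
  simp [transfer]

theorem transfer_pow_succ_apply (k : ℕ) (f : C(Y, ℝ)) (x : Y) :
    (R.transfer ℝ ^ (k + 1)) f x = ∑ j, R.weight j x * (R.transfer ℝ ^ k) f (R.map j x) := by
  rw [pow_succ', Module.End.mul_apply, transfer_apply]

theorem transfer_pow_mono_on {X : Set Y} (hX : ∀ j, Set.MapsTo (R.map j) X X) {f g : C(Y, ℝ)}
    (hfg : ∀ x ∈ X, f x ≤ g x) (k : ℕ) :
    ∀ x ∈ X, (R.transfer ℝ ^ k) f x ≤ (R.transfer ℝ ^ k) g x := by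
  induction k with
  | zero => simpa using hfg
  | succ k ih =>
    intro x hx
    rw [transfer_pow_succ_apply, transfer_pow_succ_apply]
    exact Finset.sum_le_sum fun j _ =>
      mul_le_mul_of_nonneg_left (ih _ (hX j hx)) (R.weight_pos j x).le

theorem transfer_pow_nonneg_on {X : Set Y} (hX : ∀ j, Set.MapsTo (R.map j) X X) {f : C(Y, ℝ)}
    (hf : ∀ x ∈ X, 0 ≤ f x) (k : ℕ) : ∀ x ∈ X, 0 ≤ (R.transfer ℝ ^ k) f x := by
  simpa using R.transfer_pow_mono_on hX (f := 0) hf k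

theorem transfer_pow_one_pos [Nonempty (Fin n)] (k : ℕ) (x : Y) :
    0 < (R.transfer ℝ ^ k) 1 x := by
  induction k generalizing x with
  | zero => simp
  | succ k ih =>
    rw [transfer_pow_succ_apply]
    exact Finset.sum_pos (fun j _ => mul_pos (R.weight_pos j x) (ih _)) Finset.univ_nonempty

/-- Iterates of the transfer operator commute with restriction to the attractor. -/
theorem transfer_pow_onAttractor {K : TopologicalSpace.NonemptyCompacts Y} (hK : R.IsAttractor K)
    (k : ℕ) (f : C(Y, ℝ)) (g : C(K, ℝ)) (hfg : ∀ x : K, g x = f x) (x : K) :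
    ((R.onAttractor hK).transfer ℝ ^ k) g x = (R.transfer ℝ ^ k) f x := by
  induction k generalizing x with
  | zero => simpa using hfg x
  | succ k ih =>
    rw [transfer_pow_succ_apply, transfer_pow_succ_apply]
    exact Finset.sum_congr rfl fun j _ => by rw [ih]; rfl

theorem IsAttractor.nonempty_index {R : IFSw n Y} {K : TopologicalSpace.NonemptyCompacts Y}
    (hK : R.IsAttractor K) : Nonempty (Fin n) := by
  obtain ⟨x, hx⟩ := K.nonempty
  rw [← hK] at hx
  exact ⟨(Set.mem_iUnion.1 hx).choose⟩

theorem IsEigenmeasure.integral_transfer_pow [CompactSpace Y] [MeasurableSpace Y]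
    {R : IFSw n Y} {c : ℝ} {μ : Measure Y} (h : R.IsEigenmeasure c μ) (k : ℕ) (f : C(Y, ℝ)) :
    ∫ x, (R.transfer ℝ ^ k) f x ∂μ = c ^ k * ∫ x, f x ∂μ := by
  induction k with
  | zero => simp
  | succ k ih => rw [pow_succ', Module.End.mul_apply, h, ih, pow_succ', mul_assoc]

theorem integrable_continuousMap [CompactSpace Y] [MeasurableSpace Y] [OpensMeasurableSpace Y]
    (μ : Measure Y) [IsFiniteMeasure μ] (f : C(Y, ℝ)) : Integrable f μ :=
  Integrable.of_bound f.continuous.measurable.aestronglyMeasurable ‖f‖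
    (Eventually.of_forall fun x => f.norm_coe_le_norm x)

theorem IsEigenmeasure.eigenvalue_pos [Nonempty (Fin n)] [CompactSpace Y] [MeasurableSpace Y]
    [OpensMeasurableSpace Y] {R : IFSw n Y} {c : ℝ} {μ : Measure Y} [IsProbabilityMeasure μ]
    (h : R.IsEigenmeasure c μ) : 0 < c := by
  have h1 := h.integral_transfer_pow 1 1
  simp only [pow_one, ContinuousMap.one_apply, integral_const, probReal_univ, smul_eq_mul,
    mul_one] at h1
  rw [← h1]
  have hpos : ∀ x, 0 < R.transfer ℝ 1 x := fun x => by
    simpa using R.transfer_pow_one_pos 1 x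
  rw [integral_pos_iff_support_of_nonneg (fun x => (hpos x).le) (integrable_continuousMap μ _)]
  have : Function.support (fun x => R.transfer ℝ 1 x) = Set.univ :=
    Set.eq_univ_of_forall fun x => (hpos x).ne'
  rw [this]
  simp

end TransferIterates

/-! ### Bounded distortion and convergence of the quotients. -/

section Distortion

variable {Y : Type*} [MetricSpace Y] (R : IFSw n Y)

/-- Comparison of iterates at two points: if `g ≤ h` across pairs of points which are close at the
scale reached after `l` contractions, then `B^l g` at `x` is controlled by `B^l h` at `y`. -/
theorem transfer_pow_le_exp_sum_mul {X : Set Y} (hX : ∀ j, Set.MapsTo (R.map j) X X) {c D : ℝ}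
    (hc : 0 ≤ c) (hτ : ∀ j x y, dist (R.map j x) (R.map j y) ≤ c * dist x y) {w : ℕ → ℝ}
    (hw : ∀ j i, ∀ x ∈ X, ∀ y ∈ X, dist x y ≤ c ^ i * D →
      |Real.log (R.weight j x) - Real.log (R.weight j y)| ≤ w i)
    {g h : C(Y, ℝ)} (hh : ∀ v ∈ X, 0 ≤ h v) (l : ℕ) :
    ∀ i, (∀ u ∈ X, ∀ v ∈ X, dist u v ≤ c ^ (i + l) * D → g u ≤ h v) →
      ∀ x ∈ X, ∀ y ∈ X, dist x y ≤ c ^ i * D →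
      (R.transfer ℝ ^ l) g x ≤
        Real.exp (∑ k ∈ Finset.range l, w (i + k)) * (R.transfer ℝ ^ l) h y := by
  induction l with
  | zero =>
    intro i hgh x hx y hy hxy
    simpa using hgh x hx y hy hxy
  | succ l ih =>
    intro i hgh x hx y hy hxy
    rw [transfer_pow_succ_apply, transfer_pow_succ_apply, Finset.mul_sum]
    -- The first letter costs a factor `exp (w i)` for its weight; the remaining `l` letters start
    -- one scale deeper, at `i + 1`.
    refine Finset.sum_le_sum fun j _ => ?_
    have hgh' : ∀ u ∈ X, ∀ v ∈ X, dist u v ≤ c ^ (i + 1 + l) * D → g u ≤ h v := by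
      intro u hu v hv huv
      exact hgh u hu v hv (by rwa [show i + (l + 1) = i + 1 + l by ring])
    have hd : dist (R.map j x) (R.map j y) ≤ c ^ (i + 1) * D := by
      refine (hτ j x y).trans ?_
      rw [pow_succ', mul_assoc]
      exact mul_le_mul_of_nonneg_left hxy hc
    have h1 := ih (i + 1) hgh' _ (hX j hx) _ (hX j hy) hd
    have hq : R.weight j x ≤ Real.exp (w i) * R.weight j y := by
      have h2 := (abs_le.1 (hw j i x hx y hy hxy)).2
      calc R.weight j x = Real.exp (Real.log (R.weight j x)) :=
            (Real.exp_log (R.weight_pos j x)).symm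
        _ ≤ Real.exp (w i + Real.log (R.weight j y)) := Real.exp_le_exp.2 (by linarith)
        _ = Real.exp (w i) * R.weight j y := by
            rw [Real.exp_add, Real.exp_log (R.weight_pos j y)]
    have hn := R.transfer_pow_nonneg_on hX hh l _ (hX j hy)
    have hs : ∑ k ∈ Finset.range (l + 1), w (i + k)
        = w i + ∑ k ∈ Finset.range l, w (i + 1 + k) := by
      rw [Finset.sum_range_succ', add_comm, add_zero]
      congr 1
      exact Finset.sum_congr rfl fun k _ => by congr 1; ring
    rw [hs, Real.exp_add]
    calc _ ≤ R.weight j x * (Real.exp (∑ k ∈ Finset.range l, w (i + 1 + k)) *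
            (R.transfer ℝ ^ l) h (R.map j y)) :=
          mul_le_mul_of_nonneg_left h1 (R.weight_pos j x).le
      _ ≤ (Real.exp (w i) * R.weight j y) * (Real.exp (∑ k ∈ Finset.range l, w (i + 1 + k)) *
            (R.transfer ℝ ^ l) h (R.map j y)) :=
          mul_le_mul_of_nonneg_right hq (mul_nonneg (Real.exp_pos _).le hn)
      _ = _ := by ring

/-- The quotients `B^k f / B^k 1` become constant, uniformly on a compact invariant set with
bounded distortion. -/
theorem exists_tendsto_bounds [Nonempty (Fin n)] {X : Set Y} (hXc : IsCompact X)
    (hXn : X.Nonempty) (hX : ∀ j, Set.MapsTo (R.map j) X X) {c D C : ℝ} (hc0 : 0 ≤ c)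
    (hc1 : c < 1) (hC : 0 ≤ C)
    (hcmp : ∀ l, ∀ g h : C(Y, ℝ), (∀ v ∈ X, 0 ≤ h v) →
      (∀ u ∈ X, ∀ v ∈ X, dist u v ≤ c ^ l * D → g u ≤ h v) →
      ∀ x ∈ X, ∀ y ∈ X, (R.transfer ℝ ^ l) g x ≤ C * (R.transfer ℝ ^ l) h y)
    (f : C(Y, ℝ)) :
    ∃ (m M : ℕ → ℝ) (V : ℝ), Tendsto m atTop (𝓝 V) ∧ Tendsto M atTop (𝓝 V) ∧
      ∀ k, ∀ x ∈ X, m k * (R.transfer ℝ ^ k) 1 x ≤ (R.transfer ℝ ^ k) f x ∧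
        (R.transfer ℝ ^ k) f x ≤ M k * (R.transfer ℝ ^ k) 1 x := by
  set a : ℕ → Y → ℝ := fun k x => (R.transfer ℝ ^ k) f x / (R.transfer ℝ ^ k) 1 x with ha
  have hpos : ∀ k x, 0 < (R.transfer ℝ ^ k) 1 x := R.transfer_pow_one_pos
  have hac : ∀ k, Continuous (a k) := fun k =>
    ((R.transfer ℝ ^ k) f).continuous.div ((R.transfer ℝ ^ k) 1).continuous
      fun x => (hpos k x).ne'
  have haf : ∀ k x, (R.transfer ℝ ^ k) f x = a k x * (R.transfer ℝ ^ k) 1 x := fun k x =>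
    (div_mul_cancel₀ _ (hpos k x).ne').symm
  have hmin : ∀ k, ∃ u ∈ X, ∀ x ∈ X, a k u ≤ a k x := fun k =>
    hXc.exists_isMinOn hXn (hac k).continuousOn
  have hmax : ∀ k, ∃ u ∈ X, ∀ x ∈ X, a k x ≤ a k u := fun k =>
    hXc.exists_isMaxOn hXn (hac k).continuousOn
  choose u huX hu using hmin
  choose v hvX hv using hmax
  set m : ℕ → ℝ := fun k => a k (u k) with hm
  set M : ℕ → ℝ := fun k => a k (v k) with hM
  have hbd : ∀ k, ∀ x ∈ X, m k * (R.transfer ℝ ^ k) 1 x ≤ (R.transfer ℝ ^ k) f x ∧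
      (R.transfer ℝ ^ k) f x ≤ M k * (R.transfer ℝ ^ k) 1 x := fun k x hx => by
    rw [haf]
    exact ⟨mul_le_mul_of_nonneg_right (hu k x hx) (hpos k x).le,
      mul_le_mul_of_nonneg_right (hv k x hx) (hpos k x).le⟩
  -- `a (k + 1) x` averages the values `a k (τ_j x)` with weights `q_j(x) * B^k 1 (τ_j x)`.
  have hmono : Monotone m := by
    refine monotone_nat_of_le_succ fun k => ?_
    rw [hm, ha]
    simp only
    rw [le_div_iff₀ (hpos _ _), transfer_pow_succ_apply, transfer_pow_succ_apply, Finset.mul_sum]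
    refine Finset.sum_le_sum fun j _ => ?_
    have := mul_le_mul_of_nonneg_left (hbd k _ (hX j (huX (k + 1)))).1
      (R.weight_pos j (u (k + 1))).le
    calc _ = _ := by rw [mul_left_comm]
      _ ≤ _ := this
  have hanti : Antitone M := by
    refine antitone_nat_of_succ_le fun k => ?_
    rw [hM, ha]
    simp only
    rw [div_le_iff₀ (hpos _ _), transfer_pow_succ_apply, transfer_pow_succ_apply, Finset.mul_sum]
    refine Finset.sum_le_sum fun j _ => ?_
    have := mul_le_mul_of_nonneg_left (hbd k _ (hX j (hvX (k + 1)))).2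
      (R.weight_pos j (v (k + 1))).le
    calc _ ≤ _ := this
      _ = _ := by rw [mul_left_comm]
  have hmM : ∀ k, m k ≤ M k := fun k => hu k _ (hvX k)
  have hmlim : ∃ A, Tendsto m atTop (𝓝 A) :=
    ⟨_, tendsto_atTop_ciSup hmono ⟨M 0, by
      rintro _ ⟨k, rfl⟩
      exact (hmM k).trans (hanti (Nat.zero_le k))⟩⟩
  have hMlim : ∃ B, Tendsto M atTop (𝓝 B) :=
    ⟨_, tendsto_atTop_ciInf hanti ⟨m 0, by
      rintro _ ⟨k, rfl⟩
      exact (hmono (Nat.zero_le k)).trans (hmM k)⟩⟩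
  obtain ⟨A, hA⟩ := hmlim
  obtain ⟨B, hB⟩ := hMlim
  -- A Harnack-type inequality for the nonnegative function `B^k f - m k * B^k 1`: its later maximum
  -- is controlled by its later minimum.
  have key : ∀ k, ∀ ε > 0, ∀ᶠ l in atTop,
      M (l + k) - m k ≤ C ^ 3 * (m (l + k) - m k + ε) := by
    intro k ε hε
    have huc : UniformContinuousOn (a k) X :=
      hXc.uniformContinuousOn_of_continuous (hac k).continuousOn
    obtain ⟨δ, hδ, hδa⟩ := Metric.uniformContinuousOn_iff.1 huc ε hε
    have hlim : Tendsto (fun l : ℕ => c ^ l * D) atTop (𝓝 0) := by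
      simpa using (tendsto_pow_atTop_nhds_zero_of_lt_one hc0 hc1).mul_const D
    filter_upwards [hlim.eventually (gt_mem_nhds hδ)] with l hl
    have h1 : ∀ p ∈ X, ∀ q ∈ X, (R.transfer ℝ ^ k) 1 p ≤ C * (R.transfer ℝ ^ k) 1 q :=
      hcmp k 1 1 (fun _ _ => zero_le_one) (fun _ _ _ _ _ => le_rfl)
    have h2 : ∀ p ∈ X, ∀ q ∈ X, (R.transfer ℝ ^ (l + k)) 1 p ≤ C * (R.transfer ℝ ^ (l + k)) 1 q :=
      hcmp (l + k) 1 1 (fun _ _ => zero_le_one) (fun _ _ _ _ _ => le_rfl)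
    set F := (R.transfer ℝ ^ k) f
    set H := (R.transfer ℝ ^ k) 1
    have hl1 : (R.transfer ℝ ^ l) H = (R.transfer ℝ ^ (l + k)) 1 := by
      rw [pow_add, Module.End.mul_apply]
    have hl2 : (R.transfer ℝ ^ l) F = (R.transfer ℝ ^ (l + k)) f := by
      rw [pow_add, Module.End.mul_apply]
    -- The three factors of `C` compare `H` at two nearby points, the `l`-th iterates at the maximum
    -- and minimum points, and finally `B^(l+k) 1` at these two points (`h6`).
    have h3 := hcmp l (F - m k • H) (C • (F - m k • H + ε • H)) (by
        intro p hp
        have := (hbd k p hp).1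
        have := (hpos k p).le
        simp only [ContinuousMap.smul_apply, ContinuousMap.add_apply, ContinuousMap.sub_apply,
          smul_eq_mul]
        exact mul_nonneg hC (add_nonneg (by linarith) (mul_nonneg hε.le this))) (by
        intro p hp q hq hpq
        have h4 := hδa p hp q hq (hpq.trans_lt hl)
        rw [Real.dist_eq] at h4
        have h5 := (abs_lt.1 h4).2
        simp only [ContinuousMap.smul_apply, ContinuousMap.add_apply, ContinuousMap.sub_apply,
          smul_eq_mul]
        rw [haf k p, haf k q]
        calc a k p * H p - m k * H p = (a k p - m k) * H p := by ring
          _ ≤ (a k q - m k + ε) * H p :=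
            mul_le_mul_of_nonneg_right (by linarith) (hpos k p).le
          _ ≤ (a k q - m k + ε) * (C * H q) :=
            mul_le_mul_of_nonneg_left (h1 p hp q hq) (by linarith [hu k q hq])
          _ = _ := by ring)
      (v (l + k)) (hvX _) (u (l + k)) (huX _)
    simp only [map_smul, map_add, map_sub, hl1, hl2, ContinuousMap.smul_apply,
      ContinuousMap.add_apply, ContinuousMap.sub_apply, smul_eq_mul] at h3
    rw [haf (l + k), haf (l + k)] at h3
    have h6 := h2 _ (huX (l + k)) _ (hvX (l + k))
    have hpv := hpos (l + k) (v (l + k))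
    have hnn : 0 ≤ m (l + k) - m k + ε := by linarith [hmono (Nat.le_add_left k l)]
    refine le_of_mul_le_mul_right ?_ hpv
    calc (M (l + k) - m k) * (R.transfer ℝ ^ (l + k)) 1 (v (l + k))
        = a (l + k) (v (l + k)) * (R.transfer ℝ ^ (l + k)) 1 (v (l + k))
          - m k * (R.transfer ℝ ^ (l + k)) 1 (v (l + k)) := by ring
      _ ≤ _ := h3
      _ = C ^ 2 * (m (l + k) - m k + ε) * (R.transfer ℝ ^ (l + k)) 1 (u (l + k)) := by ring
      _ ≤ C ^ 2 * (m (l + k) - m k + ε) * (C * (R.transfer ℝ ^ (l + k)) 1 (v (l + k))) :=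
        mul_le_mul_of_nonneg_left h6 (by positivity)
      _ = _ := by ring
  -- Let `l → ∞`, then `ε → 0`; letting `k → ∞` afterwards makes the right side vanish.
  have hlim1 : ∀ k, B - m k ≤ C ^ 3 * (A - m k) := by
    intro k
    refine le_of_forall_pos_le_add fun ε hε => ?_
    have hε' : 0 < ε / (C ^ 3 + 1) := by positivity
    have h := le_of_tendsto_of_tendsto (((tendsto_add_atTop_iff_nat k).2 hB).sub_const (m k))
      (((((tendsto_add_atTop_iff_nat k).2 hA).sub_const (m k)).add_const
        (ε / (C ^ 3 + 1))).const_mul (C ^ 3)) (key k _ hε')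
    have h' : C ^ 3 * (ε / (C ^ 3 + 1)) ≤ ε := by
      rw [mul_div_assoc', div_le_iff₀ (by positivity)]
      nlinarith
    linarith
  have hBA : B - A ≤ C ^ 3 * (A - A) :=
    le_of_tendsto_of_tendsto' (hA.const_sub B) ((hA.const_sub A).const_mul _) hlim1
  have hAB : A ≤ B := le_of_tendsto_of_tendsto' hA hB hmM
  have : B = A := le_antisymm (by simpa using hBA) hAB
  exact ⟨m, M, A, hA, this ▸ hB, hbd⟩

end Distortion

/-! ### Compactness of the attractor together with an orbit. -/

section Orbit

variable {Y : Type*} [MetricSpace Y] (R : IFSw n Y)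

/-- The points `τ_w x₀`, `w` a word of length `k`. -/
def orbitLevel (x₀ : Y) : ℕ → Set Y
  | 0 => {x₀}
  | k + 1 => ⋃ j, R.map j '' orbitLevel x₀ k

theorem finite_orbitLevel (x₀ : Y) (k : ℕ) : (R.orbitLevel x₀ k).Finite := by
  induction k with
  | zero => exact Set.finite_singleton _
  | succ k ih => exact Set.finite_iUnion fun j => ih.image _

theorem exists_dist_le_of_mem_orbitLevel {K : TopologicalSpace.NonemptyCompacts Y}
    (hK : R.IsAttractor K) {c : ℝ} (hc : 0 ≤ c)
    (hτ : ∀ j x y, dist (R.map j x) (R.map j y) ≤ c * dist x y) {x₀ y₀ : Y} (hy₀ : y₀ ∈ K) (k : ℕ) :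
    ∀ z ∈ R.orbitLevel x₀ k, ∃ y ∈ K, dist z y ≤ c ^ k * dist x₀ y₀ := by
  induction k with
  | zero =>
    rintro z rfl
    exact ⟨y₀, hy₀, by simp⟩
  | succ k ih =>
    intro z hz
    obtain ⟨j, z', hz', rfl⟩ := Set.mem_iUnion.1 hz
    obtain ⟨y, hy, hzy⟩ := ih z' hz'
    refine ⟨R.map j y, hK.mapsTo j hy, (hτ j z' y).trans ?_⟩
    rw [pow_succ', mul_assoc]
    exact mul_le_mul_of_nonneg_left hzy hc

/-- Finitely many members of an open cover already cover a thickening of `K`, which contains all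
orbit levels from some `N` on; the earlier levels form a finite set. -/
theorem isCompact_attractor_union_orbit {K : TopologicalSpace.NonemptyCompacts Y}
    (hK : R.IsAttractor K) {c : ℝ} (hc : 0 ≤ c) (hc1 : c < 1)
    (hτ : ∀ j x y, dist (R.map j x) (R.map j y) ≤ c * dist x y) (x₀ : Y) :
    IsCompact ((K : Set Y) ∪ ⋃ k, R.orbitLevel x₀ k) := by
  classical
  refine isCompact_of_finite_subcover fun {ι} U hU hcov => ?_
  obtain ⟨t, ht⟩ := K.isCompact.elim_finite_subcover U hU (Set.subset_union_left.trans hcov)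
  obtain ⟨δ, hδ, hδU⟩ := K.isCompact.exists_thickening_subset_open
    (isOpen_biUnion fun i (_ : i ∈ t) => hU i) ht
  obtain ⟨y₀, hy₀⟩ := K.nonempty
  have hlim : Tendsto (fun l : ℕ => c ^ l * dist x₀ y₀) atTop (𝓝 0) := by
    simpa using (tendsto_pow_atTop_nhds_zero_of_lt_one hc hc1).mul_const (dist x₀ y₀)
  obtain ⟨N, hN⟩ := eventually_atTop.1 (hlim.eventually (gt_mem_nhds hδ))
  have hfin : (⋃ k ∈ Finset.range N, R.orbitLevel x₀ k).Finite :=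
    (Finset.range N).finite_toSet.biUnion fun k _ => R.finite_orbitLevel x₀ k
  obtain ⟨s, hs⟩ := hfin.isCompact.elim_finite_subcover U hU fun z hz => by
    obtain ⟨k, _, hzk⟩ := Set.mem_iUnion₂.1 hz
    exact hcov (Or.inr (Set.mem_iUnion.2 ⟨k, hzk⟩))
  refine ⟨t ∪ s, ?_⟩
  have hts : ⋃ i ∈ t, U i ⊆ ⋃ i ∈ t ∪ s, U i :=
    Set.biUnion_mono (fun i hi => Finset.mem_union_left _ hi) fun _ _ => le_rfl
  have hss : ⋃ i ∈ s, U i ⊆ ⋃ i ∈ t ∪ s, U i :=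
    Set.biUnion_mono (fun i hi => Finset.mem_union_right _ hi) fun _ _ => le_rfl
  rintro z (hz | hz)
  · exact hts (ht hz)
  · obtain ⟨k, hzk⟩ := Set.mem_iUnion.1 hz
    by_cases hk : k < N
    · exact hss (hs (Set.mem_iUnion₂.2 ⟨k, Finset.mem_range.2 hk, hzk⟩))
    · obtain ⟨y, hy, hzy⟩ := R.exists_dist_le_of_mem_orbitLevel hK hc hτ hy₀ k z hzk
      exact hts (hδU (Metric.mem_thickening_iff.2 ⟨y, hy, hzy.trans_lt (hN k (not_lt.1 hk))⟩))

theorem mapsTo_attractor_union_orbit {K : TopologicalSpace.NonemptyCompacts Y}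
    (hK : R.IsAttractor K) (x₀ : Y) (j : Fin n) :
    Set.MapsTo (R.map j) ((K : Set Y) ∪ ⋃ k, R.orbitLevel x₀ k)
      ((K : Set Y) ∪ ⋃ k, R.orbitLevel x₀ k) := by
  rintro z (hz | hz)
  · exact Or.inl (hK.mapsTo j hz)
  · obtain ⟨k, hzk⟩ := Set.mem_iUnion.1 hz
    exact Or.inr (Set.mem_iUnion.2 ⟨k + 1, Set.mem_iUnion.2 ⟨j, z, hzk, rfl⟩⟩)

theorem Contractive.exists_uniform {R : IFSw n Y} (h : R.Contractive) :
    ∃ c : ℝ, 0 < c ∧ c < 1 ∧ ∀ j x y, dist (R.map j x) (R.map j y) ≤ c * dist x y := by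
  choose c hc using h
  -- The `1 / 2` keeps the common ratio positive, as its powers serve as scales and are inverted
  -- later.
  have hlt : max (1 / 2 : NNReal) (Finset.univ.sup c) < 1 := by
    refine max_lt (by norm_num) ?_
    rw [Finset.sup_lt_iff (by simp)]
    exact fun j _ => (hc j).1
  refine ⟨(max (1 / 2 : NNReal) (Finset.univ.sup c) : NNReal), ?_, ?_, fun j x y => ?_⟩
  · exact NNReal.coe_pos.2 (lt_max_of_lt_left (by norm_num))
  · exact_mod_cast hlt
  · refine ((hc j).2.dist_le_mul x y).trans (mul_le_mul_of_nonneg_right ?_ dist_nonneg)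
    exact NNReal.coe_le_coe.2 (le_max_of_le_right (Finset.le_sup (Finset.mem_univ j)))

end Orbit

end IFSw

/-! ### From the Dini integral to a summable modulus. -/

section Dini

variable {Y : Type*} [MetricSpace Y]

theorem oscModulus_mono (u : Y → ℝ) : Monotone (oscModulus u) := fun _ _ hst =>
  iSup_mono fun _ => iSup_mono fun _ => iSup_le fun h => le_iSup_of_le (h.trans hst) le_rfl

theorem ofReal_abs_sub_le_oscModulus (u : Y → ℝ) {x y : Y} {t : ℝ} (h : dist x y ≤ t) :
    ENNReal.ofReal |u x - u y| ≤ oscModulus u t :=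
  le_iSup_of_le x (le_iSup_of_le y (le_iSup_of_le h le_rfl))

/-- The Dini condition makes the modulus of continuity summable along a geometric progression. -/
theorem DiniWeight.tsum_oscModulus_ne_top {q : Y → ℝ} (hq : DiniWeight q) {c : ℝ} (hc : 0 < c)
    (hc1 : c < 1) : ∑' i : ℕ, oscModulus (fun x => Real.log (q x)) (c ^ (i + 1)) ≠ ⊤ := by
  set Ω := oscModulus (fun x => Real.log (q x)) with hΩ
  -- On `(c^(i+1), c^i]` the integrand is at least `Ω (c^(i+1)) / c^i`, and the interval has length
  -- `c^i * (1 - c)`.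
  have hpiece : ∀ i : ℕ, ENNReal.ofReal (1 - c) * Ω (c ^ (i + 1)) ≤
      ∫⁻ t in Set.Ioc (c ^ (i + 1)) (c ^ i), Ω t / ENNReal.ofReal t := by
    intro i
    have hci : 0 < c ^ i := pow_pos hc i
    calc ENNReal.ofReal (1 - c) * Ω (c ^ (i + 1))
        = Ω (c ^ (i + 1)) / ENNReal.ofReal (c ^ i) *
            volume (Set.Ioc (c ^ (i + 1)) (c ^ i)) := by
          rw [Real.volume_Ioc, show c ^ i - c ^ (i + 1) = c ^ i * (1 - c) by ring,
            ENNReal.ofReal_mul hci.le, ← mul_assoc, ENNReal.div_mul_cancel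
              (by simpa using hci) ENNReal.ofReal_ne_top, mul_comm]
      _ = ∫⁻ _ in Set.Ioc (c ^ (i + 1)) (c ^ i), Ω (c ^ (i + 1)) / ENNReal.ofReal (c ^ i) := by
          rw [setLIntegral_const]
      _ ≤ _ := setLIntegral_mono' measurableSet_Ioc fun t ht =>
          ENNReal.div_le_div (oscModulus_mono _ ht.1.le) (ENNReal.ofReal_le_ofReal ht.2)
  have hanti : Antitone fun i : ℕ => c ^ i := fun i j hij => pow_le_pow_of_le_one hc.le hc1.le hij
  have hdisj : Pairwise (Function.onFun Disjoint fun i : ℕ => Set.Ioc (c ^ (i + 1)) (c ^ i)) := by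
    simpa using hanti.pairwise_disjoint_on_Ioc_succ
  have hle : ENNReal.ofReal (1 - c) * ∑' i : ℕ, Ω (c ^ (i + 1)) ≤
      ∫⁻ t in Set.Ioc (0 : ℝ) 1, Ω t / ENNReal.ofReal t := by
    rw [← ENNReal.tsum_mul_left]
    calc _ ≤ ∑' i : ℕ, ∫⁻ t in Set.Ioc (c ^ (i + 1)) (c ^ i), Ω t / ENNReal.ofReal t :=
          ENNReal.tsum_le_tsum hpiece
      _ = ∫⁻ t in ⋃ i : ℕ, Set.Ioc (c ^ (i + 1)) (c ^ i), Ω t / ENNReal.ofReal t :=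
          (lintegral_iUnion (fun _ => measurableSet_Ioc) hdisj _).symm
      _ ≤ _ := lintegral_mono_set (Set.iUnion_subset fun i =>
          Set.Ioc_subset_Ioc (pow_pos hc _).le (pow_le_one₀ hc.le hc1.le))
  intro htop
  rw [htop, ENNReal.mul_top (by simpa using hc1)] at hle
  exact (hle.trans_lt hq).ne rfl

/-- Summable control of the oscillation of `log q_j` on a compact set, along the scales
`c ^ i * D`, for some `D` dominating the diameter. -/
theorem exists_summable_log_weight_osc {n : ℕ} (R : IFSw n Y)
    (hq : ∀ j, DiniWeight (R.weight j)) {X : Set Y} (hX : IsCompact X) {c : ℝ} (hc : 0 < c)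
    (hc1 : c < 1) :
    ∃ (D : ℝ) (w : ℕ → ℝ), (∀ x ∈ X, ∀ y ∈ X, dist x y ≤ D) ∧ Summable w ∧ (∀ i, 0 ≤ w i) ∧
      ∀ j i, ∀ x ∈ X, ∀ y ∈ X, dist x y ≤ c ^ i * D →
        |Real.log (R.weight j x) - Real.log (R.weight j y)| ≤ w i := by
  obtain ⟨N, hN⟩ := (tendsto_pow_atTop_atTop_of_one_lt ((one_lt_inv₀ hc).2 hc1)).eventually
    (eventually_ge_atTop (Metric.diam X)) |>.exists
  have hlogc : ∀ j, Continuous fun x => Real.log (R.weight j x) := fun j =>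
    (R.weight j).continuous.log fun x => (R.weight_pos j x).ne'
  have hb : ∀ j, ∃ b : ℝ, ∀ x ∈ X, |Real.log (R.weight j x)| ≤ b := fun j =>
    hX.exists_bound_of_continuousOn (hlogc j).continuousOn
  choose b hb using hb
  set Ω : Fin n → ℝ → ENNReal := fun j => oscModulus fun x => Real.log (R.weight j x)
  have hΩ : ∀ j, ∑' i : ℕ, Ω j (c ^ (i + 1)) ≠ ⊤ := fun j =>
    (hq j).tsum_oscModulus_ne_top hc hc1
  -- With `D = c⁻¹ ^ N` the scale `c ^ i * D` equals `c ^ (i - N)` for `i > N`, where the Dini sum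
  -- applies. The finitely many scales with `i ≤ N`, where the global modulus may be infinite, use
  -- the bound of `log q_j` on the compact set.
  refine ⟨c⁻¹ ^ N, fun i => if i ≤ N then ∑ j, 2 * |b j| else
    ∑ j, (Ω j (c ^ (i - N))).toReal, fun x hx y hy =>
      (Metric.dist_le_diam_of_mem hX.isBounded hx hy).trans hN, ?_, fun i => ?_, ?_⟩
  · refine (summable_nat_add_iff (N + 1)).1 ?_
    refine (summable_sum (s := Finset.univ) fun j _ => ENNReal.summable_toReal (hΩ j)).congr
      fun i => ?_
    rw [if_neg (by omega), show i + (N + 1) - N = i + 1 by omega]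
  · beta_reduce
    split_ifs
    · exact Finset.sum_nonneg fun j _ => by positivity
    · exact Finset.sum_nonneg fun j _ => ENNReal.toReal_nonneg
  · intro j i x hx y hy hxy
    beta_reduce
    split_ifs with hi
    · refine le_trans ?_ (Finset.single_le_sum (f := fun j => 2 * |b j|)
        (fun j _ => by positivity) (Finset.mem_univ j))
      have h1 := abs_sub (Real.log (R.weight j x)) (Real.log (R.weight j y))
      have h2 := hb j x hx
      have h3 := hb j y hy
      have h4 := le_abs_self (b j)
      linarith
    · refine le_trans ?_ (Finset.single_le_sum (f := fun j => (Ω j (c ^ (i - N))).toReal)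
        (fun j _ => ENNReal.toReal_nonneg) (Finset.mem_univ j))
      have hscale : c ^ i * c⁻¹ ^ N = c ^ (i - N) := by
        rw [inv_pow, pow_sub₀ c hc.ne' (by omega)]
      rw [hscale] at hxy
      have hfin : Ω j (c ^ (i - N)) ≠ ⊤ := by
        have := ENNReal.ne_top_of_tsum_ne_top (hΩ j) (i - N - 1)
        rwa [show i - N - 1 + 1 = i - N by omega] at this
      exact (ENNReal.ofReal_le_iff_le_toReal hfin).1
        (ofReal_abs_sub_le_oscModulus (fun x => Real.log (R.weight j x)) hxy)

end Dini

/-! ### Identification of the limit. -/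

theorem mainTheorem7 {n : ℕ} {Y : Type*} [MetricSpace Y] [MeasurableSpace Y] [BorelSpace Y]
    (R : IFSw n Y) (hτ : R.Contractive) (hq : ∀ j, DiniWeight (R.weight j))
    (K : TopologicalSpace.NonemptyCompacts Y) (hK : R.IsAttractor K)
    (μ : Measure K) [IsProbabilityMeasure μ]
    (hμ : (R.onAttractor hK).IsEigenmeasure (R.onAttractor hK).specRadius μ)
    (x₀ : Y) (f : C(Y, ℝ)) :
    Tendsto (fun k : ℕ => ((R.transfer ℝ)^[k] f) x₀ / ((R.transfer ℝ)^[k] 1) x₀) atTop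
      (𝓝 (∫ x : K, f x ∂μ)) := by
  have : Nonempty (Fin n) := hK.nonempty_index
  have : OpensMeasurableSpace K :=
    inferInstanceAs (OpensMeasurableSpace (K : Set Y))
  obtain ⟨c, hc, hc1, hcτ⟩ := hτ.exists_uniform
  set X : Set Y := (K : Set Y) ∪ ⋃ k, R.orbitLevel x₀ k
  have hXc : IsCompact X := R.isCompact_attractor_union_orbit hK hc.le hc1 hcτ x₀
  have hX : ∀ j, Set.MapsTo (R.map j) X X := R.mapsTo_attractor_union_orbit hK x₀
  have hx₀ : x₀ ∈ X := Or.inr (Set.mem_iUnion.2 ⟨0, rfl⟩)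
  obtain ⟨D, w, hD, hws, hw0, hw⟩ := exists_summable_log_weight_osc R hq hXc hc hc1
  -- Since `D` dominates all distances in `X`, comparison can start at scale `0` for any pair of
  -- points, with total distortion at most `exp (∑' i, w i)`.
  obtain ⟨m, M, V, hm, hM, hbd⟩ := R.exists_tendsto_bounds hXc ⟨x₀, hx₀⟩ hX (D := D)
    (C := Real.exp (∑' i, w i)) hc.le hc1 (Real.exp_pos _).le (fun l g h hh hgh x hx y hy => by
      refine (R.transfer_pow_le_exp_sum_mul hX hc.le hcτ hw hh l 0
        (by simpa using hgh) x hx y hy (by simpa using hD x hx y hy)).trans ?_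
      refine mul_le_mul_of_nonneg_right (Real.exp_le_exp.2 ?_)
        (R.transfer_pow_nonneg_on hX hh l y hy)
      simpa using hws.sum_le_tsum (Finset.range l) fun i _ => hw0 i) f
  simp only [← Module.End.pow_apply]
  have hratio : Tendsto (fun k : ℕ => (R.transfer ℝ ^ k) f x₀ / (R.transfer ℝ ^ k) 1 x₀) atTop
      (𝓝 V) := by
    refine tendsto_of_tendsto_of_tendsto_of_le_of_le hm hM (fun k => ?_) fun k => ?_
    · exact (le_div_iff₀ (R.transfer_pow_one_pos k x₀)).2 (hbd k x₀ hx₀).1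
    · exact (div_le_iff₀ (R.transfer_pow_one_pos k x₀)).2 (hbd k x₀ hx₀).2
  set ρ := (R.onAttractor hK).specRadius
  have hρ : 0 < ρ := hμ.eigenvalue_pos
  set g : C(K, ℝ) := ⟨fun x => f x, by fun_prop⟩
  have hgk : ∀ k (x : K), ((R.onAttractor hK).transfer ℝ ^ k) g x = (R.transfer ℝ ^ k) f x :=
    fun k x => R.transfer_pow_onAttractor hK k f g (fun _ => rfl) x
  have h1k : ∀ k (x : K), ((R.onAttractor hK).transfer ℝ ^ k) 1 x = (R.transfer ℝ ^ k) 1 x :=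
    fun k x => R.transfer_pow_onAttractor hK k 1 1 (fun _ => rfl) x
  have hint1 : ∀ k, ∫ x, ((R.onAttractor hK).transfer ℝ ^ k) 1 x ∂μ = ρ ^ k := fun k => by
    simpa using hμ.integral_transfer_pow k 1
  have hintg : ∀ k, ∫ x, ((R.onAttractor hK).transfer ℝ ^ k) g x ∂μ = ρ ^ k * ∫ x : K, f x ∂μ :=
    fun k => hμ.integral_transfer_pow k g
  have hlow : ∀ k, m k ≤ ∫ x : K, f x ∂μ := fun k => by
    have h : ∫ x, m k * ((R.onAttractor hK).transfer ℝ ^ k) 1 x ∂μ ≤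
        ∫ x, ((R.onAttractor hK).transfer ℝ ^ k) g x ∂μ :=
      integral_mono ((IFSw.integrable_continuousMap μ _).const_mul _)
        (IFSw.integrable_continuousMap μ _) fun x => by
          simp only [hgk, h1k]
          exact (hbd k x (Or.inl x.2)).1
    rw [integral_const_mul, hint1, hintg, mul_comm] at h
    exact le_of_mul_le_mul_left h (pow_pos hρ k)
  have hupp : ∀ k, ∫ x : K, f x ∂μ ≤ M k := fun k => by
    have h : ∫ x, ((R.onAttractor hK).transfer ℝ ^ k) g x ∂μ ≤
        ∫ x, M k * ((R.onAttractor hK).transfer ℝ ^ k) 1 x ∂μ :=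
      integral_mono (IFSw.integrable_continuousMap μ _)
        ((IFSw.integrable_continuousMap μ _).const_mul _) fun x => by
          simp only [hgk, h1k]
          exact (hbd k x (Or.inl x.2)).2
    rw [integral_const_mul, hint1, hintg, mul_comm (M k)] at h
    exact le_of_mul_le_mul_left h (pow_pos hρ k)
  have hV : V = ∫ x : K, f x ∂μ :=
    le_antisymm (le_of_tendsto' hm hlow) (ge_of_tendsto' hM hupp)
  exact hV ▸ hratio
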